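/- Let $d\ge 1$ and let $X$ be a random vector in $\mathbb R^d$ with law $\mu_X$ and characteristic function $\varphi$ such that: * $X$ is non-degenerate (the support of $\mu_X$ is not contained in a $(d-1)$-dimensional subspace) and $\mathbb E\|X\|<\infty$; * $X$ is self-decomposable: for every $\gamma\in(0,1)$, $\xi\mapsto\varphi(\xi)/\varphi(\gamma\xi)$ is the characteristic function of a probability measure; * $X$ is infinitely divisible with triplet $(b,0,\nu)$, i.e. $X$ has no Gaussian component: $\varphi(\xi)=\exp\big(i\langle b;\xi\rangle+\int(e^{i\langle\xi;u\rangle}-1-i\langle\xi;u\rangle\mathbf 1_{\|u\|\le1})\,\nu(du)\big)$, where $\nu(\{0\})=0$ and $\int(1\wedge\|u\|^2)\,\nu(du)<\infty$; * for Borel $B\subset\mathbb R^d\setminus\{0\}$, $\nu(B)=\int_{S^{d-1}}\lambda(dx)\int_0^\infty\mathbf 1_B(rx)k_x(r)\frac{dr}{r}$, where $\lambda$ is a probability measure on the unit sphere, $k_x(r)\ge0$ is measurable in $x$, non-increasing and right-continuous in $r>0$, $\int_0^\infty(r^2\wedge1)k_x(r)\frac{dr}{r}$ is finite and independent of $x$,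 and, for all $0<a<b<\infty$, $\sup_{r\in(a,b)}k_x(r)$ is $\lambda$-essentially bounded in $x$. For $t>0$, let $\mu_t$ be the probability measure with characteristic function $\varphi(\xi)/\varphi(e^{-t}\xi)$, and assume that $\mu_t$ has a continuously differentiable Lebesgue density $q_t$ such that, for every $1\le i\le d$, $$\lim_{y_i\to\pm\infty}q_t(y)=0,\qquad \int_{\mathbb R^d}|\partial_iq_t(y)|\,dy<\infty,\qquad I_i:=\int_0^\infty e^{-2t}\Big(\int_{\mathbb R^d}|\partial_iq_t(y)|\,dy\Big)dt<\infty .$$ Let $\mathcal H_1$ be the set of continuously differentiable $h:\mathbb R^d\to\mathbb R$ with $\sup_x|h(x)|\le1$ and $\sup_x\|\nabla h(x)\|\le1$, and let $P_th(x)=\int h(u+e^{-t}x)\,\mu_t(du)$. Then, for every $h\in\mathcal H_1$, the function $$f_h(x)=-\int_0^\infty\big(P_th(x)-\mathbb E\,h(X)\big)\,dt,\qquad x\in\mathbb R^d,$$ is well defined (for every $x$ the integrand is integrable in $t$) and twice continuously differentiable on $\mathbb R^d$. Moreover $\|\partial_if_h\|_\infty\le1$ and $\|\partial_i\partial_jf_h\|_\infty\le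 C$ for all $1\le i,j\le d$, where $C>0$ depends only on $d$ and on an upper bound for $\max_{1\le i\le d}I_i$ (in particular, for a given law $\mu_X$, it depends neither on $h$ nor on $i,j$). -/

import Mathlib

open MeasureTheory Set Filter Topology
open scoped ENNReal NNReal

namespace SDStein

noncomputable section

/-- `ℝᵈ` with its Euclidean norm and inner product; `volume` on it is Lebesgue measure. -/
abbrev Rd (d : ℕ) : Type := EuclideanSpace ℝ (Fin d)

/-- The `i`-th vector of the canonical basis. -/
abbrev e {d : ℕ} (i : Fin d) : Rd d := EuclideanSpace.single i (1 : ℝ)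

/-- The first order partial derivative `∂ᵢ f`. -/
def pderiv {d : ℕ} (i : Fin d) (f : Rd d → ℝ) : Rd d → ℝ := fun x => fderiv ℝ f x (e i)

/-! ### Infinitely divisible and self-decomposable laws -/

/-- Lévy measures on `ℝᵈ`. -/
structure IsLevyMeasure {d : ℕ} (ν : Measure (Rd d)) : Prop where
  zero : ν {0} = 0
  lintegral_lt_top : ∫⁻ u, ENNReal.ofReal (min 1 (‖u‖ ^ 2)) ∂ν < ∞

/-- The Lévy-Khintchine exponent of the triplet `(b, A, ν)`, truncated on the closed unit ball. -/
def levyExponent {d : ℕ} (b : Rd d) (A : Matrix (Fin d) (Fin d) ℝ) (ν : Measure (Rd d))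
    (ξ : Rd d) : ℂ :=
  Complex.I * ((inner ℝ b ξ : ℝ) : ℂ) - (1 / 2 : ℂ) * ((ξ.ofLp ⬝ᵥ A.mulVec ξ.ofLp : ℝ) : ℂ)
    + ∫ u, (Complex.exp (Complex.I * ((inner ℝ ξ u : ℝ) : ℂ)) - 1
        - Complex.I * ((inner ℝ ξ u : ℝ) : ℂ) * (Metric.closedBall (0 : Rd d) 1).indicator 1 u) ∂ν

/-- `μ` is infinitely divisible with triplet `(b, A, ν)`. -/
structure HasLevyTriplet {d : ℕ} (μ : Measure (Rd d)) (b : Rd d)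
    (A : Matrix (Fin d) (Fin d) ℝ) (ν : Measure (Rd d)) : Prop where
  posSemidef : A.PosSemidef
  levy : IsLevyMeasure ν
  charFun_eq : ∀ ξ, charFun μ ξ = Complex.exp (levyExponent b A ν ξ)

/-- `ρ` is a probability measure with characteristic function `φ(ξ) / φ(γ ξ)`, where `φ` is the
characteristic function of `μ`. -/
structure IsSDFactor {d : ℕ} (μ : Measure (Rd d)) (γ : ℝ) (ρ : Measure (Rd d)) : Prop where
  prob : IsProbabilityMeasure ρ
  charFun_mul : ∀ ξ, charFun ρ ξ * charFun μ (γ • ξ) = charFun μ ξ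

/-- Self-decomposability: `φ(ξ) / φ(γ ξ)` is a characteristic function for all `γ ∈ (0, 1)`. -/
def IsSelfDecomposable {d : ℕ} (μ : Measure (Rd d)) : Prop :=
  ∀ γ ∈ Ioo (0 : ℝ) 1, ∃ ρ, IsSDFactor μ γ ρ

open Classical in
/-- The probability measure with characteristic function `φ(ξ) / φ(γ ξ)` (`0` if there is none).
It is unique because characteristic functions of infinitely divisible laws do not vanish, see
`sdFactor_eq`. -/
def sdFactor {d : ℕ} (μ : Measure (Rd d)) (γ : ℝ) : Measure (Rd d) :=
  if h : ∃ ρ, IsSDFactor μ γ ρ then h.choose else 0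

theorem isSDFactor_sdFactor {d : ℕ} {μ : Measure (Rd d)} {γ : ℝ} (h : ∃ ρ, IsSDFactor μ γ ρ) :
    IsSDFactor μ γ (sdFactor μ γ) := by
  rw [sdFactor, dif_pos h]
  exact h.choose_spec

theorem sdFactor_eq {d : ℕ} {μ : Measure (Rd d)} {b : Rd d} {A : Matrix (Fin d) (Fin d) ℝ}
    {ν : Measure (Rd d)} (hμ : HasLevyTriplet μ b A ν) {γ : ℝ} {ρ : Measure (Rd d)}
    (h : IsSDFactor μ γ ρ) : sdFactor μ γ = ρ := by
  have h' := isSDFactor_sdFactor ⟨ρ, h⟩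
  have := h.prob
  have := h'.prob
  refine Measure.ext_of_charFun (funext fun ξ => ?_)
  have hne : charFun μ (γ • ξ) ≠ 0 := by
    rw [hμ.charFun_eq]
    exact Complex.exp_ne_zero _
  exact mul_right_cancel₀ hne ((h'.charFun_mul ξ).trans (h.charFun_mul ξ).symm)

/-- The law `μ_t`, with characteristic function `φ(ξ) / φ(e⁻ᵗ ξ)`. -/
def muT {d : ℕ} (μ : Measure (Rd d)) (t : ℝ) : Measure (Rd d) := sdFactor μ (Real.exp (-t))

/-- The support of `μ` is not contained in a `(d - 1)`-dimensional subspace. -/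
def IsNondegenerate {d : ℕ} (μ : Measure (Rd d)) : Prop :=
  ∀ S : Submodule ℝ (Rd d), Module.finrank ℝ S + 1 = d → ¬ μ.support ⊆ (S : Set (Rd d))

/-- The polar decomposition `ν(B) = ∫ λ(dx) ∫₀^∞ 1_B(r x) k_x(r) dr / r`, with its usual
normalization: `λ` is a probability measure on the unit sphere, `k_x(r) ≥ 0` is measurable in `x`,
nonincreasing and right-continuous in `r > 0`, and `∫ (r² ∧ 1) k_x(r) dr / r` is finite and does
not depend on `x`. -/
structure IsPolarDecomposition {d : ℕ} (ν : Measure (Rd d))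
    (lam : Measure (Metric.sphere (0 : Rd d) 1)) (k : Metric.sphere (0 : Rd d) 1 → ℝ → ℝ) :
    Prop where
  prob : IsProbabilityMeasure lam
  nonneg : ∀ x, ∀ r > 0, 0 ≤ k x r
  measurable : ∀ r > 0, Measurable fun x => k x r
  antitone : ∀ x, AntitoneOn (k x) (Ioi 0)
  rightContinuous : ∀ x, ∀ r > 0, ContinuousWithinAt (k x) (Ici r) r
  normalized : ∃ c : ℝ≥0, ∀ x,
    ∫⁻ r in Ioi (0 : ℝ), ENNReal.ofReal (min (r ^ 2) 1 * k x r / r) = c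
  apply_eq : ∀ B : Set (Rd d), MeasurableSet B → (0 : Rd d) ∉ B →
    ν B = ∫⁻ x, (∫⁻ r in Ioi (0 : ℝ),
      B.indicator 1 (r • (x : Rd d)) * ENNReal.ofReal (k x r / r)) ∂lam

/-- For `0 < a < b`, the functions `k_x` are bounded on `(a, b)`, uniformly in `λ`-almost
every `x`. -/
def LocallyBoundedK {d : ℕ} (lam : Measure (Metric.sphere (0 : Rd d) 1))
    (k : Metric.sphere (0 : Rd d) 1 → ℝ → ℝ) : Prop :=
  ∀ a b : ℝ, 0 < a → a < b → ∃ M : ℝ, ∀ᵐ x ∂lam, ∀ r ∈ Ioo a b, k x r ≤ M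

/-! ### The standing assumptions on the densities of the laws `μ_t` -/

/-- `∫₀^∞ e⁻²ᵗ (∫ |∂ᵢ q_t(y)| dy) dt`. -/
def gradIntegral {d : ℕ} (q : ℝ → Rd d → ℝ) (i : Fin d) : ℝ≥0∞ :=
  ∫⁻ t in Ioi (0 : ℝ), ENNReal.ofReal (Real.exp (-2 * t)) * ∫⁻ y, ‖pderiv i (q t) y‖ₑ

/-- For each `t > 0`, `q t` is a continuously differentiable density of `μ_t`, and the family
satisfies, for every coordinate `i`,
`q_t(y) → 0` as `yᵢ → ±∞`, `∫ |∂ᵢ q_t| < ∞` and `∫₀^∞ e⁻²ᵗ (∫ |∂ᵢ q_t|) dt < ∞`. -/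
structure HasRegularDensities {d : ℕ} (μ : Measure (Rd d)) (q : ℝ → Rd d → ℝ) : Prop where
  nonneg : ∀ t > 0, ∀ y, 0 ≤ q t y
  density : ∀ t > 0, muT μ t = volume.withDensity fun y => ENNReal.ofReal (q t y)
  contDiff : ∀ t > 0, ContDiff ℝ 1 (q t)
  tendsto_atTop : ∀ t > 0, ∀ i y, Tendsto (fun s : ℝ => q t (y + s • e i)) atTop (𝓝 0)
  tendsto_atBot : ∀ t > 0, ∀ i y, Tendsto (fun s : ℝ => q t (y + s • e i)) atBot (𝓝 0)
  integrable_pderiv : ∀ t > 0, ∀ i, Integrable (pderiv i (q t))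
  gradIntegral_lt_top : ∀ i, gradIntegral q i < ∞

/-! ### Test functions, semigroup and candidate solution of the Stein equation -/

/-- The class `𝓗_r`: `C^r` functions with `M_ℓ(h) ≤ 1` for all `0 ≤ ℓ ≤ r`, where `M_ℓ(h)` is the
supremum over `x` of the operator norm of the `ℓ`-th derivative of `h` at `x`. -/
def classH (d r : ℕ) : Set (Rd d → ℝ) :=
  {h | ContDiff ℝ r h ∧ ∀ ℓ ≤ r, ∀ x, ‖iteratedFDeriv ℝ ℓ h x‖ ≤ 1}

/-- The semigroup `P_t h(x) = ∫ h(u + e⁻ᵗ x) μ_t(du)`. -/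
def semigroupP {d : ℕ} (μ : Measure (Rd d)) (t : ℝ) (h : Rd d → ℝ) (x : Rd d) : ℝ :=
  ∫ u, h (u + Real.exp (-t) • x) ∂(muT μ t)

/-- `f_h(x) = - ∫₀^∞ (P_t h(x) - 𝔼 h(X)) dt`, where `X` has law `μ`. -/
def steinSol {d : ℕ} (μ : Measure (Rd d)) (h : Rd d → ℝ) (x : Rd d) : ℝ :=
  -∫ t in Ioi (0 : ℝ), (semigroupP μ t h x - ∫ y, h y ∂μ)

end

end SDStein

namespace SDStein

noncomputable section

variable {d : ℕ}

/-! Self-decomposability makes `μ` invariant: if `U` has law `μ_t` and `X'` is an independent copy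
of `X`, then `U + e⁻ᵗ X'` has law `μ`. Coupling with the same `U` gives `|P_t h(x) - 𝔼 h(X)| ≤ e⁻ᵗ
𝔼‖x - X‖`, so the time integral converges (`abs_semigroupP_sub_integral_le`).

The chain rule gives `∂ⱼ P_t h = e⁻ᵗ P_t(∂ⱼ h)`, bounded by `e⁻ᵗ`, whose integral is 1: this is the
first-order bound. A second derivative cannot fall on `h`, which is only `C¹`. Translation
invariance moves it onto the density `q_t` (`contDiff_integral_translate`), so that `|∂ᵢ∂ⱼ P_t h| ≤
e⁻²ᵗ ∫ |∂ᵢ q_t|`, and integration in `t` gives `Iᵢ`.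

What remains is measurability in `t`, as no regularity of `q_t` in `t` is given. The characteristic
function of `μ` does not vanish, so those of the `μ_t` are continuous in `t`, and Lévy's theorem
makes `(t, x) ↦ P_t g(x)` jointly continuous for bounded continuous `g` (`continuous_transitionOp`).
`contDiff_integral_Ioi` then differentiates under the time integral. -/

/-! ### Derivatives in coordinates. -/

theorem clm_apply_eq_sum (L : Rd d →L[ℝ] ℝ) (v : Rd d) : L v = ∑ i, v i * L (e i) := by
  conv_lhs => rw [← (EuclideanSpace.basisFun (Fin d) ℝ).sum_repr v]
  simp [map_sum]

theorem norm_clm_le_sum (L : Rd d →L[ℝ] ℝ) : ‖L‖ ≤ ∑ i, |L (e i)| := by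
  refine L.opNorm_le_bound (Finset.sum_nonneg fun i _ => abs_nonneg _) fun v => ?_
  rw [clm_apply_eq_sum, Finset.sum_mul]
  refine (norm_sum_le _ _).trans (Finset.sum_le_sum fun i _ => ?_)
  rw [norm_mul, mul_comm, Real.norm_eq_abs (L (e i))]
  exact mul_le_mul_of_nonneg_left (PiLp.norm_apply_le v i) (abs_nonneg _)

theorem norm_e (i : Fin d) : ‖(e i : Rd d)‖ = 1 := by simp

theorem _root_.ContDiff.continuous_pderiv {f : Rd d → ℝ} (hf : ContDiff ℝ 1 f) (i : Fin d) :
    Continuous (pderiv i f) :=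
  (hf.continuous_fderiv one_ne_zero).clm_apply continuous_const

theorem contDiff_two_of_contDiff_pderiv {f : Rd d → ℝ} (hf : Differentiable ℝ f)
    (h : ∀ i, ContDiff ℝ 1 (pderiv i f)) : ContDiff ℝ 2 f := by
  rw [show (2 : WithTop ℕ∞) = 1 + 1 by norm_num, contDiff_succ_iff_fderiv_apply]
  refine ⟨hf, by simp, fun y => ?_⟩
  simp_rw [clm_apply_eq_sum _ y]
  exact ContDiff.sum fun i _ => contDiff_const.mul (h i)

/-! ### Differentiation of integrals over a half-line -/

/-- Differentiation under `∫₀^∞ dt`; the bounds `β i` on the partial derivatives need not be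
measurable. -/
theorem contDiff_integral_Ioi {a : ℝ → Rd d → ℝ} {β : Fin d → ℝ → ℝ≥0∞}
    (ha : Continuous (Function.uncurry a)) (had : ∀ t > 0, ContDiff ℝ 1 (a t))
    (hint : ∀ x, IntegrableOn (fun t => a t x) (Ioi 0))
    (hb : ∀ t > 0, ∀ i x, ‖pderiv i (a t) x‖ₑ ≤ β i t)
    (hβ : ∀ i, ∫⁻ t in Ioi (0 : ℝ), β i t ≠ ∞) :
    ContDiff ℝ 1 (fun x => ∫ t in Ioi (0 : ℝ), a t x) ∧
      ∀ i x, pderiv i (fun x => ∫ t in Ioi (0 : ℝ), a t x) x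
          = ∫ t in Ioi (0 : ℝ), pderiv i (a t) x ∧
        ‖pderiv i (fun x => ∫ t in Ioi (0 : ℝ), a t x) x‖ₑ ≤ ∫⁻ t in Ioi (0 : ℝ), β i t := by
  -- Measurable substitute for `β i`: by continuity in `x`, the supremum over a countable dense set
  -- bounds the partial derivative everywhere, and it stays below `β i`.
  set B : Fin d → ℝ → ℝ≥0∞ := fun i t =>
    ⨆ n : ℕ, ‖pderiv i (a t) (TopologicalSpace.denseSeq (Rd d) n)‖ₑ with hB
  have hmeas : ∀ x, Measurable fun t => fderiv ℝ (a t) x := fun x =>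
    (measurable_fderiv_with_param ℝ ha).comp (measurable_id.prodMk measurable_const)
  have hBm : ∀ i, Measurable (B i) := fun i => Measurable.iSup fun n =>
    ((ContinuousLinearMap.measurable_apply (e i)).comp (hmeas _)).enorm
  have hBβ : ∀ i, ∀ t > 0, B i t ≤ β i t := fun i t ht => iSup_le fun n => hb t ht i _
  have hBfin : ∀ i, ∫⁻ t in Ioi (0 : ℝ), B i t ≠ ∞ := fun i =>
    ne_top_of_le_ne_top (hβ i) (setLIntegral_mono' measurableSet_Ioi fun t ht => hBβ i t ht)
  have hle : ∀ t > 0, ∀ i x, ‖pderiv i (a t) x‖ₑ ≤ B i t := by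
    intro t ht i x
    have hc : IsClosed {x | ‖pderiv i (a t) x‖ₑ ≤ B i t} :=
      isClosed_le ((had t ht).continuous_pderiv i).enorm continuous_const
    refine (TopologicalSpace.denseRange_denseSeq (Rd d)).induction_on x hc fun n => ?_
    exact le_iSup (fun n => ‖pderiv i (a t) (TopologicalSpace.denseSeq (Rd d) n)‖ₑ) n
  have hBae : ∀ᵐ t ∂volume.restrict (Ioi (0 : ℝ)), ∀ i, B i t < ∞ :=
    ae_all_iff.2 fun i => ae_lt_top (hBm i) (hBfin i)
  have hbound : ∀ᵐ t ∂volume.restrict (Ioi (0 : ℝ)), ∀ x,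
      ‖fderiv ℝ (a t) x‖ ≤ ∑ i, (B i t).toReal := by
    filter_upwards [hBae, ae_restrict_mem measurableSet_Ioi] with t htB ht x
    refine (norm_clm_le_sum _).trans (Finset.sum_le_sum fun i _ => ?_)
    rw [← Real.norm_eq_abs, ← toReal_enorm]
    exact ENNReal.toReal_mono (htB i).ne (hle t ht i x)
  have hbint : Integrable (fun t => ∑ i, (B i t).toReal) (volume.restrict (Ioi (0 : ℝ))) :=
    integrable_finsetSum _ fun i _ =>
      integrable_toReal_of_lintegral_ne_top (hBm i).aemeasurable (hBfin i)
  have hF : ∀ x, HasFDerivAt (fun x => ∫ t in Ioi (0 : ℝ), a t x)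
      (∫ t in Ioi (0 : ℝ), fderiv ℝ (a t) x) x := by
    intro x
    refine hasFDerivAt_integral_of_dominated_of_fderiv_le (s := univ)
      (F' := fun x t => fderiv ℝ (a t) x) univ_mem
      (Eventually.of_forall fun x => (hint x).aestronglyMeasurable) (hint x)
      (hmeas x).aestronglyMeasurable ?_ hbint ?_
    · filter_upwards [hbound] with t ht x _ using ht x
    · filter_upwards [ae_restrict_mem measurableSet_Ioi] with t ht x _
      exact ((had t ht).differentiable one_ne_zero x).hasFDerivAt
  have hfi : ∀ x, Integrable (fun t => fderiv ℝ (a t) x) (volume.restrict (Ioi (0 : ℝ))) :=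
    fun x => hbint.mono' (hmeas x).aestronglyMeasurable (by
      filter_upwards [hbound] with t ht using ht x)
  have hp : ∀ i x, pderiv i (fun x => ∫ t in Ioi (0 : ℝ), a t x) x
      = ∫ t in Ioi (0 : ℝ), pderiv i (a t) x := by
    intro i x
    rw [pderiv, (hF x).fderiv, ContinuousLinearMap.integral_apply (hfi x)]
    rfl
  refine ⟨?_, fun i x => ⟨hp i x, ?_⟩⟩
  · rw [contDiff_one_iff_fderiv]
    refine ⟨fun x => (hF x).differentiableAt, ?_⟩
    rw [funext fun x => (hF x).fderiv]
    refine continuous_of_dominated (fun x => (hmeas x).aestronglyMeasurable)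
      (fun x => by filter_upwards [hbound] with t ht using ht x) hbint ?_
    filter_upwards [ae_restrict_mem measurableSet_Ioi] with t ht
    exact (had t ht).continuous_fderiv one_ne_zero
  · rw [hp]
    exact (enorm_integral_le_lintegral_enorm _).trans
      (setLIntegral_mono' measurableSet_Ioi fun t ht => hb t ht i x)

/-! ### Translates of an integrable density -/

/-- The error `F (y + v) - F y - G y v` is the integral of `(G (y + r • v) - G y) v`, which is
`o(‖v‖)` by continuity of `G` at `y`. -/
theorem hasFDerivAt_of_sub_eq_integral {F : Rd d → ℝ} {G : Rd d → Rd d →L[ℝ] ℝ}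
    (hG : Continuous G)
    (h : ∀ y v, F (y + v) - F y = ∫ r in (0 : ℝ)..1, G (y + r • v) v) (y : Rd d) :
    HasFDerivAt F (G y) y := by
  rw [hasFDerivAt_iff_isLittleO_nhds_zero, Asymptotics.isLittleO_iff]
  intro c hc
  obtain ⟨δ, hδ, hδc⟩ := Metric.continuous_iff.1 hG y c hc
  filter_upwards [Metric.ball_mem_nhds (0 : Rd d) hδ] with v hv
  rw [mem_ball_zero_iff] at hv
  have hi : IntervalIntegrable (fun r : ℝ => G (y + r • v) v) volume 0 1 :=
    Continuous.intervalIntegrable (by fun_prop) _ _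
  have heq : F (y + v) - F y - G y v = ∫ r in (0 : ℝ)..1, (G (y + r • v) - G y) v := by
    simp only [_root_.sub_apply]
    rw [intervalIntegral.integral_sub hi (by simp), h]
    simp
  rw [heq]
  have := intervalIntegral.norm_integral_le_of_norm_le_const (a := (0 : ℝ)) (b := 1)
    (f := fun r => (G (y + r • v) - G y) v) (C := c * ‖v‖) (fun r hr => ?_)
  · simpa using this
  · rw [uIoc_of_le zero_le_one] at hr
    refine (ContinuousLinearMap.le_opNorm _ _).trans ?_
    gcongr
    rw [← dist_eq_norm]
    refine (hδc _ ?_).le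
    rw [dist_eq_norm, add_sub_cancel_left, norm_smul, Real.norm_of_nonneg hr.1.le]
    calc r * ‖v‖ ≤ 1 * ‖v‖ := by gcongr; exact hr.2
      _ < δ := by simpa using hv

theorem integrable_fderiv_of_pderiv {q : Rd d → ℝ} (hq : ContDiff ℝ 1 q)
    (hqd : ∀ i, Integrable (pderiv i q)) : Integrable (fderiv ℝ q) :=
  (integrable_finsetSum Finset.univ fun i _ => (hqd i).abs).mono'
    (hq.continuous_fderiv one_ne_zero).aestronglyMeasurable
    (ae_of_all _ fun _ => norm_clm_le_sum _)

theorem sub_eq_integral_fderiv {q : Rd d → ℝ} (hq : ContDiff ℝ 1 q) (u v : Rd d) :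
    q (u - v) - q u = -∫ r in (0 : ℝ)..1, fderiv ℝ q (u - r • v) v := by
  have hd : ∀ r : ℝ, HasDerivAt (fun r : ℝ => q (u - r • v)) (-(fderiv ℝ q (u - r • v) v)) r := by
    intro r
    have h1 : HasDerivAt (fun r : ℝ => u - r • v) (-v) r := by
      simpa using ((hasDerivAt_id r).smul_const v).const_sub u
    have h2 := (hq.differentiable one_ne_zero (u - r • v)).hasFDerivAt.comp_hasDerivAt r h1
    rwa [map_neg] at h2
  have hc : Continuous (fderiv ℝ q) := hq.continuous_fderiv one_ne_zero
  have := intervalIntegral.integral_eq_sub_of_hasDerivAt (a := (0 : ℝ)) (b := 1)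
    (fun r _ => hd r) (Continuous.intervalIntegrable (by fun_prop) _ _)
  rw [intervalIntegral.integral_neg] at this
  simpa using this.symm

/-- Translation invariance of Lebesgue measure moves the shift `v` from `g` to `q`. The fundamental
theorem of calculus is then applied to `q` along the segment, and after Fubini the shift `r • v` is
moved back to `g`, which need not be differentiable. -/
theorem integral_translate_sub_eq {g q : Rd d → ℝ} (hg : Continuous g) (hg1 : ∀ x, |g x| ≤ 1)
    (hq : ContDiff ℝ 1 q) (hqi : Integrable q) (hqd : ∀ i, Integrable (pderiv i q))
    (y v : Rd d) :
    (∫ u, g (u + (y + v)) * q u) - ∫ u, g (u + y) * q u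
      = ∫ r in (0 : ℝ)..1, -∫ u, g (u + (y + r • v)) * fderiv ℝ q u v := by
  have hDi := integrable_fderiv_of_pderiv hq hqd
  have hDc : Continuous (fderiv ℝ q) := hq.continuous_fderiv one_ne_zero
  have hDv : Integrable (fun u => fderiv ℝ q u v) := hDi.apply_continuousLinearMap v
  have hgb : ∀ f : Rd d → ℝ, Integrable f → Integrable fun u => g (u + y) * f u := fun f hf =>
    hf.bdd_mul (c := 1) (by fun_prop) (ae_of_all _ fun u => hg1 _)
  have h1 : ∫ u, g (u + (y + v)) * q u = ∫ u, g (u + y) * q (u - v) := by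
    rw [← integral_add_right_eq_self (fun u => g (u + y) * q (u - v)) v]
    simp [add_assoc, add_comm v y]
  rw [h1, ← integral_sub (hgb _ (hqi.comp_sub_right v)) (hgb _ hqi)]
  have h2 : ∀ u, g (u + y) * q (u - v) - g (u + y) * q u
      = -∫ r in (0 : ℝ)..1, g (u + y) * fderiv ℝ q (u - r • v) v := fun u => by
    rw [← mul_sub, sub_eq_integral_fderiv hq, intervalIntegral.integral_const_mul, mul_neg]
  simp_rw [h2]
  rw [integral_neg, intervalIntegral.integral_neg, ← intervalIntegral_integral_swap]
  · congr 1
    refine intervalIntegral.integral_congr fun r _ => ?_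
    beta_reduce
    rw [← integral_add_right_eq_self (fun u => g (u + y) * fderiv ℝ q (u - r • v) v) (r • v)]
    simp [add_assoc, add_comm (r • v) y]
  -- Fubini: since `|g| ≤ 1`, each slice in `r` has `L¹` norm at most `∫ |fderiv ℝ q u v|`,
  -- uniformly in `r`.
  · have hcont : Continuous (Function.uncurry fun (r : ℝ) (u : Rd d) =>
        g (u + y) * fderiv ℝ q (u - r • v) v) := by
      simp only [Function.uncurry_def]; fun_prop
    rw [integrable_prod_iff hcont.aestronglyMeasurable]
    refine ⟨ae_of_all _ fun r => hgb _ (hDv.comp_sub_right (r • v)), ?_⟩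
    have hfin : IsFiniteMeasure (volume.restrict (uIoc (0 : ℝ) 1)) := by
      rw [uIoc_of_le zero_le_one]; infer_instance
    refine (integrable_const (∫ u, ‖fderiv ℝ q u v‖)).mono'
      hcont.norm.stronglyMeasurable.integral_prod_right.aestronglyMeasurable
      (ae_of_all _ fun r => ?_)
    rw [Real.norm_of_nonneg (integral_nonneg fun _ => norm_nonneg _),
      ← integral_sub_right_eq_self (fun u => ‖fderiv ℝ q u v‖) (r • v)]
    refine integral_mono (hgb _ (hDv.comp_sub_right (r • v))).norm
      (hDv.comp_sub_right (r • v)).norm fun u => ?_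
    simp only [Function.uncurry_apply_pair, norm_mul]
    exact mul_le_of_le_one_left (norm_nonneg _) (hg1 _)

/-- A bounded continuous function is turned into a `C¹` one by integrating its translates against a
density with integrable gradient. -/
theorem contDiff_integral_translate {g q : Rd d → ℝ} (hg : Continuous g) (hg1 : ∀ x, |g x| ≤ 1)
    (hq : ContDiff ℝ 1 q) (hqi : Integrable q) (hqd : ∀ i, Integrable (pderiv i q)) :
    ContDiff ℝ 1 (fun y => ∫ u, g (u + y) * q u) ∧
      ∀ i y, ‖pderiv i (fun y => ∫ u, g (u + y) * q u) y‖ₑ ≤ ∫⁻ u, ‖pderiv i q u‖ₑ := by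
  have hDi := integrable_fderiv_of_pderiv hq hqd
  have hDc : Continuous (fderiv ℝ q) := hq.continuous_fderiv one_ne_zero
  have hGi : ∀ y, Integrable fun u => g (u + y) • fderiv ℝ q u := fun y =>
    hDi.bdd_smul (C := 1)
      (hg.comp (continuous_add_const y)).aestronglyMeasurable (ae_of_all _ fun u => hg1 _)
  set G : Rd d → Rd d →L[ℝ] ℝ := fun y => -∫ u, g (u + y) • fderiv ℝ q u with hGdef
  have hGapp : ∀ y v, G y v = -∫ u, g (u + y) * fderiv ℝ q u v := by
    intro y v
    simp only [hGdef, _root_.neg_apply]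
    rw [ContinuousLinearMap.integral_apply (hGi y)]
    rfl
  have hG : Continuous G := by
    refine (continuous_of_dominated (fun y => (hGi y).aestronglyMeasurable) (fun y =>
      ae_of_all _ fun u => ?_) hDi.norm (ae_of_all _ fun u => by fun_prop)).neg
    rw [norm_smul]
    exact mul_le_of_le_one_left (norm_nonneg _) (hg1 _)
  have hF := hasFDerivAt_of_sub_eq_integral (F := fun y => ∫ u, g (u + y) * q u) hG
    fun y v => by
      simp_rw [hGapp]
      exact integral_translate_sub_eq hg hg1 hq hqi hqd y v
  refine ⟨?_, fun i y => ?_⟩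
  · rw [contDiff_one_iff_fderiv]
    refine ⟨fun x => (hF x).differentiableAt, ?_⟩
    rwa [funext fun x => (hF x).fderiv]
  · rw [pderiv, (hF y).fderiv, hGapp, enorm_neg]
    refine (enorm_integral_le_lintegral_enorm _).trans (lintegral_mono fun u => ?_)
    rw [enorm_mul]
    refine mul_le_of_le_one_left' ?_
    rw [← ofReal_norm, ENNReal.ofReal_le_one]
    exact hg1 _

/-! ### Weak continuity of the transition laws -/

/-- Lévy's continuity theorem for families of laws indexed by a sequential space. -/
theorem continuous_integral_of_continuous_charFun {T : Type*} [TopologicalSpace T]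
    [SequentialSpace T] (P : T → Measure (Rd d)) [∀ t, IsProbabilityMeasure (P t)]
    (hP : ∀ ξ, Continuous fun t => charFun (P t) ξ) {g : Rd d → ℝ} (hg : Continuous g)
    (hg1 : ∀ x, |g x| ≤ 1) : Continuous fun t => ∫ u, g u ∂(P t) := by
  refine SeqContinuous.continuous fun s t hs => ?_
  have h := (ProbabilityMeasure.tendsto_iff_tendsto_charFun
    (μ := fun n => (⟨P (s n), inferInstance⟩ : ProbabilityMeasure (Rd d)))
    (μ₀ := ⟨P t, inferInstance⟩)).2 fun ξ => ((hP ξ).tendsto t).comp hs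
  exact ProbabilityMeasure.tendsto_iff_forall_integral_tendsto.1 h
    (BoundedContinuousFunction.ofNormedAddCommGroup g hg 1 hg1)

/-- The laws `μ_t` for `t > 0`, extended by the Dirac mass at the origin for `t ≤ 0`. -/
def transitionLaw (μ : Measure (Rd d)) (t : ℝ) : Measure (Rd d) :=
  if 0 < t then muT μ t else Measure.dirac 0

theorem transitionLaw_of_pos (μ : Measure (Rd d)) {t : ℝ} (ht : 0 < t) :
    transitionLaw μ t = muT μ t := if_pos ht

theorem isSDFactor_muT {μ : Measure (Rd d)} (hμ : IsSelfDecomposable μ) {t : ℝ} (ht : 0 < t) :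
    IsSDFactor μ (Real.exp (-t)) (muT μ t) :=
  isSDFactor_sdFactor (hμ _ ⟨Real.exp_pos _, by simpa using ht⟩)

theorem isProbabilityMeasure_transitionLaw {μ : Measure (Rd d)} (hμ : IsSelfDecomposable μ)
    (t : ℝ) : IsProbabilityMeasure (transitionLaw μ t) := by
  rw [transitionLaw]
  split_ifs with ht
  · exact (isSDFactor_muT hμ ht).prob
  · infer_instance

/-- Truncating at `max t 0` covers the Dirac mass too, where the quotient is 1. The single formula
is continuous across `t = 0`. -/
theorem charFun_transitionLaw {μ : Measure (Rd d)} (hμ : IsSelfDecomposable μ)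
    (hne : ∀ ξ, charFun μ ξ ≠ 0) (t : ℝ) (ξ : Rd d) :
    charFun (transitionLaw μ t) ξ = charFun μ ξ / charFun μ (Real.exp (-max t 0) • ξ) := by
  rw [eq_div_iff (hne _), transitionLaw]
  split_ifs with ht
  · rw [max_eq_left ht.le, (isSDFactor_muT hμ ht).charFun_mul]
  · simp [max_eq_right (not_lt.1 ht), charFun_dirac]

theorem continuous_charFun (μ : Measure (Rd d)) [IsFiniteMeasure μ] : Continuous (charFun μ) := by
  simp only [funext charFun_apply]
  refine continuous_of_dominated (bound := fun _ => 1)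
    (fun ξ => Continuous.aestronglyMeasurable (by fun_prop)) (fun ξ => ae_of_all _ fun x => ?_)
    (integrable_const _) (ae_of_all _ fun x => by fun_prop)
  exact (Complex.norm_exp_ofReal_mul_I _).le

/-- The semigroup `P_t`, for all real `t`. -/
def transitionOp (μ : Measure (Rd d)) (t : ℝ) (g : Rd d → ℝ) (x : Rd d) : ℝ :=
  ∫ u, g (u + Real.exp (-t) • x) ∂(transitionLaw μ t)

theorem transitionOp_of_pos (μ : Measure (Rd d)) {t : ℝ} (ht : 0 < t) (g : Rd d → ℝ)
    (x : Rd d) : transitionOp μ t g x = semigroupP μ t g x := by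
  rw [transitionOp, transitionLaw_of_pos μ ht, semigroupP]

/-- Absorb the shift `e⁻ᵗ x` into the law: the translated law has a characteristic function
continuous in `(t, x)`, so Lévy's theorem applies on `ℝ × ℝᵈ`. -/
theorem continuous_transitionOp {μ : Measure (Rd d)} [IsProbabilityMeasure μ]
    (hμ : IsSelfDecomposable μ) (hne : ∀ ξ, charFun μ ξ ≠ 0) {g : Rd d → ℝ} (hg : Continuous g)
    (hg1 : ∀ x, |g x| ≤ 1) :
    Continuous (Function.uncurry fun t x => transitionOp μ t g x) := by
  have hprob := isProbabilityMeasure_transitionLaw hμ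
  set P : ℝ × Rd d → Measure (Rd d) := fun p =>
    (transitionLaw μ p.1).map (· + Real.exp (-p.1) • p.2) with hPdef
  have hP : ∀ p, IsProbabilityMeasure (P p) := fun p =>
    Measure.isProbabilityMeasure_map (by fun_prop)
  have heq : (Function.uncurry fun t x => transitionOp μ t g x) = fun p => ∫ u, g u ∂(P p) := by
    funext p
    simp only [Function.uncurry, transitionOp, hPdef]
    rw [integral_map (by fun_prop) hg.aestronglyMeasurable]
  rw [heq]
  refine continuous_integral_of_continuous_charFun P (fun ξ => ?_) hg hg1
  simp only [hPdef, charFun_map_add_const, charFun_transitionLaw hμ hne]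
  have hc := continuous_charFun μ
  refine (Continuous.div continuous_const (by fun_prop) fun p => hne _).mul (by fun_prop)

theorem abs_transitionOp_le {μ : Measure (Rd d)} (hμ : IsSelfDecomposable μ) {g : Rd d → ℝ}
    (hg1 : ∀ x, |g x| ≤ 1) (t : ℝ) (x : Rd d) : |transitionOp μ t g x| ≤ 1 := by
  have hprob := isProbabilityMeasure_transitionLaw hμ t
  simpa [transitionOp] using norm_integral_le_of_norm_le_const (μ := transitionLaw μ t) (C := 1)
    (f := fun u => g (u + Real.exp (-t) • x)) (ae_of_all _ fun u => hg1 _)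

/-! ### Convergence of the semigroup to equilibrium -/

theorem muT_conv_map_smul {μ : Measure (Rd d)} [IsProbabilityMeasure μ]
    (hμ : IsSelfDecomposable μ) {t : ℝ} (ht : 0 < t) :
    muT μ t ∗ μ.map (Real.exp (-t) • ·) = μ := by
  have hf := isSDFactor_muT hμ ht
  have := hf.prob
  have : IsProbabilityMeasure (μ.map (Real.exp (-t) • ·)) :=
    Measure.isProbabilityMeasure_map (by fun_prop)
  refine Measure.ext_of_charFun (funext fun ξ => ?_)
  rw [charFun_conv, charFun_map_smul, hf.charFun_mul]

theorem abs_semigroupP_sub_integral_le {μ : Measure (Rd d)} [IsProbabilityMeasure μ]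
    (hμ : IsSelfDecomposable μ) (hμ1 : Integrable (fun y => ‖y‖) μ) {h : Rd d → ℝ}
    (hh1 : ∀ x, |h x| ≤ 1) (hL : LipschitzWith 1 h) {t : ℝ} (ht : 0 < t) (x : Rd d) :
    |semigroupP μ t h x - ∫ y, h y ∂μ| ≤ Real.exp (-t) * ∫ y, ‖x - y‖ ∂μ := by
  have := (isSDFactor_muT hμ ht).prob
  have : IsProbabilityMeasure (μ.map (Real.exp (-t) • ·)) :=
    Measure.isProbabilityMeasure_map (by fun_prop)
  have hb : ∀ (ρ : Measure (Rd d)) [IsProbabilityMeasure ρ] (c : Rd d → Rd d), Continuous c →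
      Integrable (fun u => h (c u)) ρ := fun ρ _ c hc =>
    (integrable_const (1 : ℝ)).mono' (hL.continuous.comp hc).aestronglyMeasurable
      (ae_of_all _ fun u => hh1 _)
  have hxy : Integrable (fun y => ‖x - y‖) μ :=
    ((integrable_const x).sub ((integrable_norm_iff (by fun_prop)).1 hμ1)).norm
  -- Invariance of `μ` puts both terms under the same integral over `u`; the Lipschitz bound then
  -- compares `x` with `y`.
  have h1 : ∫ y, h y ∂μ = ∫ u, ∫ y, h (u + Real.exp (-t) • y) ∂μ ∂(muT μ t) := by
    conv_lhs => rw [← muT_conv_map_smul hμ ht]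
    rw [integral_conv (hb _ (fun u => u) continuous_id)]
    congr 1 with u
    rw [integral_map (f := fun y => h (u + y)) (by fun_prop)
      (hL.continuous.comp (continuous_const_add u)).aestronglyMeasurable]
  have hi2 : Integrable (fun u => ∫ y, h (u + Real.exp (-t) • y) ∂μ) (muT μ t) := by
    refine (integrable_const (1 : ℝ)).mono' ?_ (ae_of_all _ fun u => ?_)
    · refine StronglyMeasurable.aestronglyMeasurable
        (StronglyMeasurable.integral_prod_right (f := fun u y => h (u + Real.exp (-t) • y)) ?_)
      have := hL.continuous
      exact Continuous.stronglyMeasurable (by simp only [Function.uncurry_def]; fun_prop)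
    · simpa using norm_integral_le_of_norm_le_const (μ := μ) (C := 1)
        (f := fun y => h (u + Real.exp (-t) • y)) (ae_of_all _ fun y => hh1 _)
  rw [h1, semigroupP, ← integral_sub (hb _ _ (by fun_prop)) hi2, ← Real.norm_eq_abs]
  refine (norm_integral_le_of_norm_le_const
    (C := Real.exp (-t) * ∫ y, ‖x - y‖ ∂μ) (ae_of_all _ fun u => ?_)).trans (by simp)
  have h2 : h (u + Real.exp (-t) • x) - ∫ y, h (u + Real.exp (-t) • y) ∂μ
      = ∫ y, (h (u + Real.exp (-t) • x) - h (u + Real.exp (-t) • y)) ∂μ := by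
    rw [integral_sub (integrable_const _) (hb _ _ (by fun_prop))]
    simp
  rw [h2, ← integral_const_mul]
  refine norm_integral_le_of_norm_le (hxy.const_mul _) (ae_of_all _ fun y => ?_)
  refine (hL.norm_sub_le _ _).trans (le_of_eq ?_)
  rw [NNReal.coe_one, one_mul, add_sub_add_left_eq_sub, ← smul_sub, norm_smul,
    Real.norm_of_nonneg (Real.exp_pos _).le]

/-! ### The class `𝓗₁` -/

section ClassH

variable {h : Rd d → ℝ}

theorem contDiff_of_mem_classH (hh : h ∈ classH d 1) : ContDiff ℝ 1 h := hh.1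

theorem abs_le_one_of_mem_classH (hh : h ∈ classH d 1) (x : Rd d) : |h x| ≤ 1 := by
  simpa using hh.2 0 zero_le_one x

theorem norm_fderiv_le_one_of_mem_classH (hh : h ∈ classH d 1) (x : Rd d) :
    ‖fderiv ℝ h x‖ ≤ 1 := by
  rw [← norm_iteratedFDeriv_one]
  exact hh.2 1 le_rfl x

theorem abs_pderiv_le_one_of_mem_classH (hh : h ∈ classH d 1) (i : Fin d) (x : Rd d) :
    |pderiv i h x| ≤ 1 := by
  refine ((fderiv ℝ h x).le_opNorm (e i)).trans ?_
  rw [norm_e, mul_one]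
  exact norm_fderiv_le_one_of_mem_classH hh x

theorem lipschitzWith_of_mem_classH (hh : h ∈ classH d 1) : LipschitzWith 1 h :=
  lipschitzWith_of_nnnorm_fderiv_le ((contDiff_of_mem_classH hh).differentiable one_ne_zero)
    fun x => by exact_mod_cast norm_fderiv_le_one_of_mem_classH hh x

end ClassH

/-! ### Derivatives of the semigroup -/

/-- Differentiation under the integral, dominated by the constant `e⁻ᵗ` because `‖fderiv ℝ h‖ ≤ 1`;
the factor `e⁻ᵗ` is the chain rule. -/
theorem contDiff_transitionOp {μ : Measure (Rd d)} (hμ : IsSelfDecomposable μ) {h : Rd d → ℝ}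
    (hh : h ∈ classH d 1) (t : ℝ) :
    ContDiff ℝ 1 (fun x => transitionOp μ t h x) ∧
      ∀ i x, pderiv i (fun x => transitionOp μ t h x) x
        = Real.exp (-t) * transitionOp μ t (pderiv i h) x := by
  have hprob := isProbabilityMeasure_transitionLaw hμ t
  have hC := contDiff_of_mem_classH hh
  have hc : Continuous h := hC.continuous
  have hD : Continuous (fderiv ℝ h) := hC.continuous_fderiv one_ne_zero
  set ρ := transitionLaw μ t
  set s := Real.exp (-t) with hs
  have hb : ∀ u x, ‖s • fderiv ℝ h (u + s • x)‖ ≤ s := fun u x => by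
    rw [norm_smul, Real.norm_of_nonneg (Real.exp_pos _).le]
    exact mul_le_of_le_one_right (Real.exp_pos _).le (norm_fderiv_le_one_of_mem_classH hh _)
  have hm : ∀ x, AEStronglyMeasurable (fun u => s • fderiv ℝ h (u + s • x)) ρ := fun x =>
    Continuous.aestronglyMeasurable (by fun_prop)
  have hF : ∀ x, HasFDerivAt (fun x => transitionOp μ t h x)
      (∫ u, s • fderiv ℝ h (u + s • x) ∂ρ) x := by
    intro x
    refine hasFDerivAt_integral_of_dominated_of_fderiv_le (s := univ) (bound := fun _ => s)
      (F' := fun x u => s • fderiv ℝ h (u + s • x)) univ_mem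
      (Eventually.of_forall fun x => Continuous.aestronglyMeasurable (by fun_prop)) ?_
      (hm x) (ae_of_all _ fun u x _ => hb u x) (integrable_const _)
      (ae_of_all _ fun u x _ => ?_)
    · exact (integrable_const (1 : ℝ)).mono' (Continuous.aestronglyMeasurable (by fun_prop))
        (ae_of_all _ fun u => abs_le_one_of_mem_classH hh _)
    · have h1 : HasFDerivAt (fun x : Rd d => u + s • x) (s • ContinuousLinearMap.id ℝ (Rd d)) x :=
        ((hasFDerivAt_id x).const_smul s).const_add u
      have h2 := (hC.differentiable one_ne_zero (u + s • x)).hasFDerivAt.comp x h1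
      convert! h2 using 1
      ext v
      simp
  refine ⟨?_, fun i x => ?_⟩
  · rw [contDiff_one_iff_fderiv]
    refine ⟨fun x => (hF x).differentiableAt, ?_⟩
    rw [funext fun x => (hF x).fderiv]
    exact continuous_of_dominated hm (fun x => ae_of_all _ fun u => hb u x)
      (integrable_const s) (ae_of_all _ fun u => by fun_prop)
  · rw [pderiv, (hF x).fderiv, ContinuousLinearMap.integral_apply
      ((integrable_const s).mono' (hm x) (ae_of_all _ fun u => hb u x)), transitionOp,
      ← integral_const_mul]
    rfl

theorem integrable_density {μ : Measure (Rd d)} (hμ : IsSelfDecomposable μ)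
    {q : ℝ → Rd d → ℝ} (hq : HasRegularDensities μ q) {t : ℝ} (ht : 0 < t) :
    Integrable (q t) := by
  have := (isSDFactor_muT hμ ht).prob
  have h1 : ∫⁻ y, ENNReal.ofReal (q t y) = 1 := by
    rw [← setLIntegral_univ, ← withDensity_apply _ MeasurableSet.univ, ← hq.density t ht,
      measure_univ]
  refine ⟨(hq.contDiff t ht).continuous.aestronglyMeasurable, ?_⟩
  rw [hasFiniteIntegral_iff_ofReal (ae_of_all _ (hq.nonneg t ht)), h1]
  exact ENNReal.one_lt_top

theorem integral_muT {μ : Measure (Rd d)} {q : ℝ → Rd d → ℝ} (hq : HasRegularDensities μ q)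
    {t : ℝ} (ht : 0 < t) (g : Rd d → ℝ) : ∫ u, g u ∂(muT μ t) = ∫ u, g u * q t u := by
  rw [hq.density t ht, integral_withDensity_eq_integral_toReal_smul
    (hq.contDiff t ht).continuous.measurable.ennreal_ofReal (ae_of_all _ fun _ => by simp)]
  congr 1 with u
  rw [ENNReal.toReal_ofReal (hq.nonneg t ht u), smul_eq_mul, mul_comm]

/-- The smoothing effect of the semigroup. -/
theorem contDiff_transitionOp_of_density {μ : Measure (Rd d)} (hμ : IsSelfDecomposable μ)
    {q : ℝ → Rd d → ℝ} (hq : HasRegularDensities μ q) {g : Rd d → ℝ} (hg : Continuous g)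
    (hg1 : ∀ x, |g x| ≤ 1) {t : ℝ} (ht : 0 < t) :
    ContDiff ℝ 1 (fun x => transitionOp μ t g x) ∧
      ∀ i x, ‖pderiv i (fun x => transitionOp μ t g x) x‖ₑ
        ≤ ENNReal.ofReal (Real.exp (-t)) * ∫⁻ y, ‖pderiv i (q t) y‖ₑ := by
  obtain ⟨hF, hFd⟩ := contDiff_integral_translate hg hg1 (hq.contDiff t ht)
    (integrable_density hμ hq ht) (hq.integrable_pderiv t ht)
  set F : Rd d → ℝ := fun y => ∫ u, g (u + y) * q t u
  have heq : (fun x => transitionOp μ t g x) = fun x => F (Real.exp (-t) • x) := by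
    funext x
    rw [transitionOp, transitionLaw_of_pos μ ht, integral_muT hq ht]
  rw [heq]
  refine ⟨hF.comp (contDiff_const_smul _), fun i x => ?_⟩
  have h1 : pderiv i (fun x => F (Real.exp (-t) • x)) x
      = Real.exp (-t) * pderiv i F (Real.exp (-t) • x) := by
    simp only [pderiv]
    rw [fderiv_comp_smul]
    simp
  rw [h1, enorm_mul, Real.enorm_of_nonneg (Real.exp_pos _).le]
  exact mul_le_mul_right (hFd i _) _

/-! ### Integration in time and the Stein solution. -/

theorem integrableOn_exp_neg : IntegrableOn (fun t : ℝ => Real.exp (-t)) (Ioi 0) := by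
  simpa using exp_neg_integrableOn_Ioi 0 one_pos

theorem lintegral_exp_neg : ∫⁻ t in Ioi (0 : ℝ), ENNReal.ofReal (Real.exp (-t)) = 1 := by
  rw [← ofReal_integral_eq_lintegral_ofReal integrableOn_exp_neg
    (ae_of_all _ fun t => (Real.exp_pos _).le), integral_exp_neg_Ioi_zero, ENNReal.ofReal_one]

/-- Regularity of the solution of the Stein equation. -/
theorem steinSol_regularity {μ : Measure (Rd d)} [IsProbabilityMeasure μ]
    (hμ : IsSelfDecomposable μ) (hne : ∀ ξ, charFun μ ξ ≠ 0)
    (hμ1 : Integrable (fun y => ‖y‖) μ) {q : ℝ → Rd d → ℝ} (hq : HasRegularDensities μ q)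
    {h : Rd d → ℝ} (hh : h ∈ classH d 1) :
    (∀ x, IntegrableOn (fun t => semigroupP μ t h x - ∫ y, h y ∂μ) (Ioi 0)) ∧
      ContDiff ℝ 2 (steinSol μ h) ∧
      (∀ i x, |pderiv i (steinSol μ h) x| ≤ 1) ∧
      ∀ i j x, ‖pderiv i (pderiv j (steinSol μ h)) x‖ₑ ≤ gradIntegral q i := by
  have hC := contDiff_of_mem_classH hh
  have hh1 := abs_le_one_of_mem_classH hh
  have hp1 := abs_pderiv_le_one_of_mem_classH hh
  set c := ∫ y, h y ∂μ with hc
  set a : ℝ → Rd d → ℝ := fun t x => transitionOp μ t h x - c with ha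
  have hacont : Continuous (Function.uncurry a) :=
    (continuous_transitionOp hμ hne hC.continuous hh1).sub continuous_const
  have haP : ∀ x, ∀ t ∈ Ioi (0 : ℝ), a t x = semigroupP μ t h x - c := fun x t ht => by
    rw [ha, ← transitionOp_of_pos μ ht]
  have haint : ∀ x, IntegrableOn (fun t => a t x) (Ioi 0) := fun x =>
    (integrableOn_exp_neg.mul_const (∫ y, ‖x - y‖ ∂μ)).mono'
      (hacont.comp (continuous_id.prodMk continuous_const)).aestronglyMeasurable (by
        filter_upwards [ae_restrict_mem measurableSet_Ioi] with t ht
        rw [haP x t ht]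
        exact abs_semigroupP_sub_integral_le hμ hμ1 hh1 (lipschitzWith_of_mem_classH hh) ht x)
  have had : ∀ t i x, pderiv i (a t) x = Real.exp (-t) * transitionOp μ t (pderiv i h) x :=
    fun t i x => by
      rw [← (contDiff_transitionOp hμ hh t).2, pderiv, pderiv, ha, fderiv_sub_const]
  have hsol : steinSol μ h = fun x => -∫ t in Ioi (0 : ℝ), a t x := by
    funext x
    rw [steinSol, setIntegral_congr_fun measurableSet_Ioi fun t ht => (haP x t ht).symm]
  obtain ⟨hF, hFd⟩ := contDiff_integral_Ioi
    (β := fun _ t => ENNReal.ofReal (Real.exp (-t))) hacont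
    (fun t _ => (contDiff_transitionOp hμ hh t).1.sub contDiff_const) haint
    (fun t _ i x => by
      rw [had, enorm_mul, Real.enorm_of_nonneg (Real.exp_pos _).le]
      refine mul_le_of_le_one_right' ?_
      rw [← ofReal_norm, ENNReal.ofReal_le_one]
      exact abs_transitionOp_le hμ (hp1 i) t x)
    (fun _ => by rw [lintegral_exp_neg]; exact ENNReal.one_ne_top)
  have hneg : ∀ (F : Rd d → ℝ) (i : Fin d), pderiv i (fun x => -F x) = fun x => -pderiv i F x := by
    intro F i
    funext x
    simp only [pderiv]
    rw [fderiv_fun_neg]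
    rfl
  have hd1 : ∀ i, pderiv i (steinSol μ h) = fun x =>
      -∫ t in Ioi (0 : ℝ), Real.exp (-t) * transitionOp μ t (pderiv i h) x := by
    intro i
    rw [hsol, hneg]
    funext x
    rw [(hFd i x).1]
    simp_rw [had]
  have key : ∀ j, ContDiff ℝ 1 (pderiv j (steinSol μ h)) ∧
      ∀ i x, ‖pderiv i (pderiv j (steinSol μ h)) x‖ₑ ≤ gradIntegral q i := by
    intro j
    have hpc := hC.continuous_pderiv j
    have hcont : Continuous (Function.uncurry fun (t : ℝ) x =>
        Real.exp (-t) * transitionOp μ t (pderiv j h) x) :=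
      (Continuous.rexp (by fun_prop)).mul (continuous_transitionOp hμ hne hpc (hp1 j))
    -- In `e⁻²ᵗ`, one factor comes from the first derivative and one from the chain rule in the
    -- smoothing step. Only the outer derivative `i` reaches `q t`, so the bound does not depend on
    -- `j`.
    obtain ⟨hG, hGd⟩ := contDiff_integral_Ioi
      (β := fun i t => ENNReal.ofReal (Real.exp (-2 * t)) * ∫⁻ y, ‖pderiv i (q t) y‖ₑ) hcont
      (fun t ht => contDiff_const.mul
        (contDiff_transitionOp_of_density hμ hq hpc (hp1 j) ht).1)
      (fun x => integrableOn_exp_neg.mono'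
        (hcont.comp (continuous_id.prodMk continuous_const)).aestronglyMeasurable
        (ae_of_all _ fun t => by
          rw [norm_mul, Real.norm_of_nonneg (Real.exp_pos _).le]
          exact mul_le_of_le_one_right (Real.exp_pos _).le (abs_transitionOp_le hμ (hp1 j) t x)))
      (fun t ht i x => by
        have hd := contDiff_transitionOp_of_density hμ hq hpc (hp1 j) ht
        rw [pderiv, fderiv_const_mul (hd.1.differentiable one_ne_zero x), smul_apply,
          smul_eq_mul, enorm_mul, Real.enorm_of_nonneg (Real.exp_pos _).le,
          show -2 * t = -t + -t by ring, Real.exp_add,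
          ENNReal.ofReal_mul (Real.exp_pos _).le, mul_assoc]
        exact mul_le_mul_right (hd.2 i x) _)
      (fun i => (hq.gradIntegral_lt_top i).ne)
    rw [hd1]
    exact ⟨hG.neg, fun i x => by rw [hneg, enorm_neg]; exact (hGd i x).2⟩
  refine ⟨fun x => (haint x).congr_fun (haP x) measurableSet_Ioi,
    contDiff_two_of_contDiff_pderiv ?_ fun j => (key j).1, fun i x => ?_,
    fun i j x => (key j).2 i x⟩
  · rw [hsol]
    exact (hF.differentiable one_ne_zero).neg
  · have := (hFd i x).2
    rw [lintegral_exp_neg, ← ofReal_norm, ENNReal.ofReal_le_one] at this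
    rw [hsol, hneg, abs_neg]
    exact this

end

end SDStein

theorem mainTheorem9 (d : ℕ) (hd : 1 ≤ d) (K : ℝ≥0) :
    ∃ C : ℝ, 0 < C ∧
      ∀ (μ : Measure (SDStein.Rd d)) (b : SDStein.Rd d) (ν : Measure (SDStein.Rd d))
        (lam : Measure (Metric.sphere (0 : SDStein.Rd d) 1))
        (k : Metric.sphere (0 : SDStein.Rd d) 1 → ℝ → ℝ)
        (q : ℝ → SDStein.Rd d → ℝ),
        IsProbabilityMeasure μ →
        SDStein.IsSelfDecomposable μ →
        SDStein.IsNondegenerate μ →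
        SDStein.HasLevyTriplet μ b 0 ν →
        Integrable (fun y => ‖y‖) μ →
        SDStein.IsPolarDecomposition ν lam k →
        SDStein.LocallyBoundedK lam k →
        SDStein.HasRegularDensities μ q →
        (∀ i, SDStein.gradIntegral q i ≤ K) →
        ∀ h ∈ SDStein.classH d 1,
          (∀ x, IntegrableOn (fun t => SDStein.semigroupP μ t h x - ∫ y, h y ∂μ) (Ioi 0)) ∧
          ContDiff ℝ 2 (SDStein.steinSol μ h) ∧
          (∀ i x, |SDStein.pderiv i (SDStein.steinSol μ h) x| ≤ 1) ∧
          (∀ i j x,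
            |SDStein.pderiv i (SDStein.pderiv j (SDStein.steinSol μ h)) x| ≤ C) := by
  -- `K` itself is the bound; the maximum with 1 only ensures `0 < C` when `K = 0`.
  refine ⟨max K 1, by positivity, ?_⟩
  intro μ b ν lam k q hprob hμ _ htriplet hμ1 _ _ hq hK h hh
  have hne : ∀ ξ, charFun μ ξ ≠ 0 := fun ξ => by
    rw [htriplet.charFun_eq]
    exact Complex.exp_ne_zero _
  obtain ⟨h1, h2, h3, h4⟩ := SDStein.steinSol_regularity hμ hne hμ1 hq hh
  refine ⟨h1, h2, h3, fun i j x => le_max_of_le_left ?_⟩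
  have := (h4 i j x).trans (hK i)
  rwa [← ofReal_norm, ← ENNReal.ofReal_coe_nnreal,
    ENNReal.ofReal_le_ofReal_iff K.coe_nonneg] at this
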